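/- A stationary reader with carrier frequency $f_c>0$ estimates the Doppler shift of a tag reply. A tag moving radially with speed $v\ge 0$ has the (two-way) Doppler shift $f_D=2vf_c/c$, where $c>0$ is the speed of light. The noiseless received baseband signal is $s(t)=a(t)\,e^{-j2\pi\nu(t-t_0)}$ with Doppler shift $\nu$ and time offset $t_0$; it is received in complex white Gaussian noise of one-sided power spectral density $N_0>0$ with average signal power $P_S>0$. The Modified Cramér–Rao Bound for $\nu$ is $$\sigma^2_{MCRB}=\frac{N_0/2}{\min_{t_0}\ \mathbb E\int\left|\partial s(t)/\partial\nu\right|^2dt},$$ where the expectation is over the transmitted data. The reply consists either of one signal of length $T_0>0$, or of two signals of lengths $T_1,T_2>0$ separated by a pause of length $T_{pause}\ge 0$. For PSK, $a(t)=\pm\sqrt{P_S}$ during the signals, with signs given by arbitrary (possibly random) data. For ASK, each signal is divided into symbols of equal length, and $a(t)=\sqrt{2P_S}$ in the first half of every symbol and $0$ in the second half. Outside the signals, $a(t)=0$. The Doppler shift estimate is normally distributed around the true shift with variance $\sigma^2$. Stationary and moving tags are equally likely, and a tag is classified as moving if its estimate is at least $f_D/2$, and as stationary otherwise. A variance is tolerable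 for $v$ if the probability of misclassification is at most $P_{err}$, where $0<P_{err}<\frac12$; $\sigma^2_{max}(v)$ is the greatest tolerable variance. Motion detection with error probability $P_{err}$ is possible at speed $v$ if some tolerable variance is at least $\sigma^2_{MCRB}$. **Theorem.** For PSK, the minimum speed at which motion detection with error probability $P_{err}$ is possible is $$v_{min}=\frac{c\,\mathrm{erf}^{-1}(1-2P_{err})}{\pi f_c}\sqrt{\frac{3}{C_T}\frac{N_0}{P_S}},$$ where $C_T=T_0^3$ for one signal and $$C_T=(T_1+T_2)^3+12\,T_1T_2T_{pause}\,\frac{T_1+T_2+T_{pause}}{T_1+T_2}$$ for two signals. It is positive, and it is the only $v>0$ with $\sigma^2_{max}(v)=\sigma^2_{MCRB}$. For ASK with any positive number of symbols per signal, the minimum speed exists, is positive, and is the only $v>0$ with $\sigma^2_{max}(v)=\sigma^2_{MCRB}$; it converges to the same $v_{min}$ when the number of symbols of every signal tends to infinity. -/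

import Mathlib

open scoped NNReal
open MeasureTheory ProbabilityTheory Filter Topology

namespace RFID

noncomputable section

/-! ### The error function and its inverse -/

/-- The error function `erf x = (2 / √π) ∫₀ˣ exp (-t²) dt`. -/
def erf (x : ℝ) : ℝ := 2 / √Real.pi * ∫ t in (0 : ℝ)..x, Real.exp (-t ^ 2)

/-- The inverse error function (its values matter on `(-1, 1)`, the range of `erf`). -/
def erfInv : ℝ → ℝ := Function.invFun erf

/-! ### Received tag signals -/

/-- Two-way Doppler shift `f_D = 2 (v / c) f_c` of a tag moving radially with speed `v`. -/
def dopplerShift (c fc v : ℝ) : ℝ := 2 * (v / c) * fc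

/-- Transmission times of a tag reply that consists of one signal of length `T0`. -/
def oneSignalWindow (T0 : ℝ) : Set ℝ := Set.Ico 0 T0

/-- Transmission times of a reply that consists of two signals of lengths `T1`, `T2`, separated by
a pause of length `Tpause`. -/
def twoSignalWindow (T1 T2 Tpause : ℝ) : Set ℝ :=
  Set.Ico 0 T1 ∪ Set.Ico (T1 + Tpause) (T1 + Tpause + T2)

open Classical in
/-- PSK baseband amplitude: `√P_S` in the zero state, `√P_S exp(jπ)` in the one state, and `0`
outside the transmission window. `oneState` is the set of times spent in the one state, that is,
it carries the data. -/
def pskAmplitude (PS : ℝ) (window oneState : Set ℝ) (t : ℝ) : ℂ :=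
  if t ∈ window then
    (if t ∈ oneState then (√PS : ℂ) * Complex.exp (Real.pi * Complex.I) else (√PS : ℂ))
  else 0

open Classical in
/-- ASK (on-off keying) baseband amplitude: `√(2 P_S)` while the tag reflects, `0` otherwise. -/
def askAmplitude (PS : ℝ) (reflect : Set ℝ) (t : ℝ) : ℂ :=
  if t ∈ reflect then (√(2 * PS) : ℂ) else 0

/-- Reflect state times of a signal that starts at time `s` and consists of `L` symbols of length
`T`, the tag being in the reflect state during the first half of every symbol. -/
def reflectTimes (s T : ℝ) (L : ℕ) : Set ℝ :=
  {t | ∃ l : ℕ, l < L ∧ s + l * T ≤ t ∧ t < s + l * T + T / 2}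

/-- Reflect state times of one ASK signal of length `T0` with `L` symbols. -/
def oneSignalReflect (T0 : ℝ) (L : ℕ) : Set ℝ := reflectTimes 0 (T0 / L) L

/-- Reflect state times of two ASK signals of lengths `T1`, `T2` with `L1`, `L2` symbols, separated
by a pause of length `Tpause`. -/
def twoSignalReflect (T1 T2 Tpause : ℝ) (L1 L2 : ℕ) : Set ℝ :=
  reflectTimes 0 (T1 / L1) L1 ∪ reflectTimes (T1 + Tpause) (T2 / L2) L2

/-- Noiseless received signal with amplitude `a`, Doppler shift `ν` and time offset `t0`. -/
def receivedSignal (a : ℝ → ℂ) (t0 ν t : ℝ) : ℂ :=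
  a t * Complex.exp (-(2 * Real.pi * ν * (t - t0) : ℝ) * Complex.I)

/-! ### The Modified Cramér-Rao Bound -/

variable {Ω : Type*} [MeasurableSpace Ω]

/-- `E [∫ |∂s(t)/∂ν|² dt]`, the expectation being over the (random) data in the amplitude. -/
def sensitivity (P : Measure Ω) (a : Ω → ℝ → ℂ) (ν t0 : ℝ) : ℝ :=
  ∫ ω, (∫ t : ℝ, ‖deriv (fun ν' : ℝ => receivedSignal (a ω) t0 ν' t) ν‖ ^ 2) ∂P

/-- The Modified Cramér-Rao Bound for estimating the Doppler shift, at the true value `ν`, in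
complex white Gaussian noise with one-sided power spectral density `N0`:
`(N0 / 2) / E [∫ |∂s(t)/∂ν|² dt]`, the denominator being minimised over the time offset `t0`. -/
def mcrb (N0 : ℝ) (P : Measure Ω) (a : Ω → ℝ → ℂ) (ν : ℝ) : ℝ :=
  (N0 / 2) / ⨅ t0 : ℝ, sensitivity P a ν t0

/-! ### Motion detection -/

/-- Classification error probability when the estimated Doppler shift is normally distributed
around the true one with variance `σ2`, stationary tags (shift `0`) and tags moving with speed `v`
(shift `f_D`) are equally likely, and a tag is classified as moving if and only if the estimate is
at least the threshold `f_D / 2`. -/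
def errorProb (c fc v : ℝ) (σ2 : ℝ≥0) : ℝ :=
  (1 / 2) * (gaussianReal (dopplerShift c fc v) σ2).real (Set.Iio (dopplerShift c fc v / 2)) +
  (1 / 2) * (gaussianReal 0 σ2).real (Set.Ici (dopplerShift c fc v / 2))

/-- The variances of the Doppler shift estimate for which tags moving with speed `v` are told from
stationary ones with error probability at most `Perr`. -/
def tolerableVariances (c fc Perr v : ℝ) : Set ℝ :=
  {s | 0 ≤ s ∧ errorProb c fc v s.toNNReal ≤ Perr}

/-- Detection of motion with speed `v` is possible with error probability `Perr`: some tolerable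
variance is not below the Modified Cramér-Rao Bound, neither for the stationary tag nor for the
moving one. -/
def MotionDetectionPossible (c fc Perr N0 : ℝ) (P : Measure Ω) (a : Ω → ℝ → ℂ) (v : ℝ) : Prop :=
  ∃ s ∈ tolerableVariances c fc Perr v,
    mcrb N0 P a 0 ≤ s ∧ mcrb N0 P a (dopplerShift c fc v) ≤ s

/-- `w` is the minimum speed for which motion detection is possible. -/
def IsMinimumSpeed (c fc Perr N0 : ℝ) (P : Measure Ω) (a : Ω → ℝ → ℂ) (w : ℝ) : Prop :=
  IsLeast {v : ℝ | 0 ≤ v ∧ MotionDetectionPossible c fc Perr N0 P a v} w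

/-- `w` is the only positive speed for which the maximum tolerable variance and the
Modified Cramér-Rao Bound (at the Doppler shift of that speed) coincide. -/
def IsBalancingSpeed (c fc Perr N0 : ℝ) (P : Measure Ω) (a : Ω → ℝ → ℂ) (w : ℝ) : Prop :=
  0 < w ∧ ∀ v : ℝ, 0 < v →
    (IsGreatest (tolerableVariances c fc Perr v) (mcrb N0 P a (dopplerShift c fc v)) ↔ v = w)

/-! ### The closed form -/

/-- The timing constant of one signal. -/
def oneSignalConst (T0 : ℝ) : ℝ := T0 ^ 3

/-- The timing constant of two signals. -/
def twoSignalConst (T1 T2 Tpause : ℝ) : ℝ :=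
  (T1 + T2) ^ 3 + 12 * T1 * T2 * Tpause * ((T1 + T2 + Tpause) / (T1 + T2))

/-- The closed-form minimum speed, for the timing constant `CT`. -/
def minSpeed (c fc Perr N0 PS CT : ℝ) : ℝ :=
  c * erfInv (1 - 2 * Perr) / (Real.pi * fc) * √(3 / CT * (N0 / PS))

end

end RFID

namespace RFID

variable {Ω : Type*} [MeasurableSpace Ω]

/-! The squared derivative in `ν` is `(2π)² |a t|² (t - t0)²`, so neither `ν` nor the data signs
matter. If `|a|²` equals `Q` on a set `S` and vanishes elsewhere, the sensitivity is a multiple of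
the moment of inertia of `S` about `t0`; it is least at the mean time, and the bound depends only on
`Q` and the central moment `e` (`mcrb_eq`). For `v > 0` the tolerable variances form an interval
from 0 to a multiple of `v²` (`tolerableVariances_eq_Icc`). Comparing a constant with this
increasing endpoint gives one threshold speed, both minimal and balancing
(`isMinimumSpeed_and_isBalancingSpeed`). It remains to compute `e` by the parallel axis theorem. -/

/-! ### Error function and Gaussian tails. -/

theorem integrable_exp_neg_sq : Integrable fun t : ℝ => Real.exp (-t ^ 2) := by
  simpa using integrable_exp_neg_mul_sq one_pos

theorem hasDerivAt_erf (x : ℝ) : HasDerivAt erf (2 / √Real.pi * Real.exp (-x ^ 2)) x := by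
  have hc : Continuous fun t : ℝ => Real.exp (-t ^ 2) := by fun_prop
  exact (intervalIntegral.integral_hasDerivAt_right (hc.intervalIntegrable _ _)
    (hc.stronglyMeasurableAtFilter _ _) hc.continuousAt).const_mul _

theorem erf_strictMono : StrictMono erf :=
  strictMono_of_deriv_pos fun x => by rw [(hasDerivAt_erf x).deriv]; positivity

theorem continuous_erf : Continuous erf :=
  continuous_iff_continuousAt.2 fun x => (hasDerivAt_erf x).continuousAt

@[simp] theorem erf_zero : erf 0 = 0 := by simp [erf]

theorem tendsto_erf_atTop : Tendsto erf atTop (𝓝 1) := by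
  have h := (intervalIntegral_tendsto_integral_Ioi 0 integrable_exp_neg_sq.integrableOn
    tendsto_id).const_mul (2 / √Real.pi)
  have h1 : ∫ t in Set.Ioi (0 : ℝ), Real.exp (-t ^ 2) = √Real.pi / 2 := by
    simpa using integral_gaussian_Ioi 1
  have hpi : √Real.pi ≠ 0 := by positivity
  rw [h1, show 2 / √Real.pi * (√Real.pi / 2) = 1 by field_simp] at h
  exact h

theorem erf_erfInv {y : ℝ} (h0 : 0 ≤ y) (h1 : y < 1) : erf (erfInv y) = y :=
  Function.invFun_eq (mem_range_of_exists_le_of_exists_ge continuous_erf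
    ⟨0, by simpa using h0⟩ (tendsto_erf_atTop.eventually_const_le h1).exists)

theorem erfInv_pos {y : ℝ} (h0 : 0 < y) (h1 : y < 1) : 0 < erfInv y := by
  rw [← erf_strictMono.lt_iff_lt, erf_erfInv h0.le h1, erf_zero]; exact h0

/-- Upper tails of a centred normal distribution, in terms of the error function. -/
theorem gaussianReal_real_Ioi {v : ℝ≥0} (hv : v ≠ 0) (x : ℝ) :
    (gaussianReal 0 v).real (Set.Ioi x) = (1 - erf (x / √(2 * v))) / 2 := by
  have hv' : (0 : ℝ) < v := by positivity
  have hs : 0 < √(2 * (v : ℝ)) := by positivity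
  have hss : √(2 * (v : ℝ)) ^ 2 = 2 * v := Real.sq_sqrt (by positivity)
  have hp : 0 < √Real.pi := by positivity
  have hpdf : gaussianPDFReal 0 v =
      fun t => (√Real.pi * √(2 * v))⁻¹ * (fun u => Real.exp (-u ^ 2)) (t / √(2 * v)) := by
    funext t
    have h1 : √(2 * Real.pi * v) = √Real.pi * √(2 * v) := by
      rw [← Real.sqrt_mul Real.pi_pos.le]; ring_nf
    simp only [gaussianPDFReal, h1, div_pow, hss, sub_zero, neg_div]
  have hI := integrable_gaussianPDFReal 0 v
  have h0 : ∫ t in Set.Ioi (0 : ℝ), gaussianPDFReal 0 v t = 1 / 2 := by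
    rw [hpdf, integral_const_mul]
    have := integral_comp_mul_right_Ioi (fun u : ℝ => Real.exp (-u ^ 2)) 0 (inv_pos.2 hs)
    simp only [← div_eq_mul_inv] at this
    rw [this]
    have h1 : ∫ t in Set.Ioi (0 : ℝ), Real.exp (-t ^ 2) = √Real.pi / 2 := by
      simpa using integral_gaussian_Ioi 1
    simp only [zero_div, h1, inv_inv, smul_eq_mul]
    field_simp
  have h2 : ∫ t in (0 : ℝ)..x, gaussianPDFReal 0 v t = erf (x / √(2 * v)) / 2 := by
    rw [hpdf, intervalIntegral.integral_const_mul,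
      intervalIntegral.integral_comp_div (fun u : ℝ => Real.exp (-u ^ 2)) hs.ne', erf]
    simp only [zero_div, smul_eq_mul]
    field_simp
  have h3 := intervalIntegral.integral_interval_add_Ioi (a := 0) (b := x)
    hI.integrableOn hI.integrableOn
  rw [Measure.real, gaussianReal_apply_eq_integral 0 hv, ENNReal.toReal_ofReal
    (integral_nonneg fun t => gaussianPDFReal_nonneg 0 v t)]
  linarith

/-! ### Misclassification probability and tolerable variances. -/

theorem errorProb_of_ne_zero (c fc v : ℝ) {s : ℝ≥0} (hs : s ≠ 0) :
    errorProb c fc v s = (1 - erf (dopplerShift c fc v / 2 / √(2 * s))) / 2 := by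
  have := nullSingletonClass_gaussianReal (μ := 0) hs
  set d := dopplerShift c fc v with hd
  -- The reflection `t ↦ d - t` swaps the two hypotheses and fixes the threshold, so a miss is as
  -- likely as a false alarm.
  have h1 : (gaussianReal d s).real (Set.Iio (d / 2)) =
      (gaussianReal 0 s).real (Set.Ioi (d / 2)) := by
    have h := gaussianReal_map_const_sub (μ := 0) (v := s) d
    rw [sub_zero] at h
    rw [← h, map_measureReal_apply (by fun_prop) measurableSet_Iio]
    congr 1
    ext t
    simp only [Set.mem_preimage, Set.mem_Iio, Set.mem_Ioi]
    constructor <;> intro h <;> linarith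
  have h2 : (gaussianReal 0 s).real (Set.Ici (d / 2)) =
      (gaussianReal 0 s).real (Set.Ioi (d / 2)) :=
    measureReal_congr Ioi_ae_eq_Ici.symm
  rw [errorProb, ← hd, h1, h2, gaussianReal_real_Ioi hs]
  ring

theorem dopplerShift_pos {c fc v : ℝ} (hc : 0 < c) (hfc : 0 < fc) (hv : 0 < v) :
    0 < dopplerShift c fc v := by unfold dopplerShift; positivity

/-- Both hypotheses coincide at speed 0, so the error is exactly 1/2, even for the Dirac mass of
variance 0. -/
theorem tolerableVariances_zero (c fc : ℝ) {Perr : ℝ} (h : Perr < 1 / 2) :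
    tolerableVariances c fc Perr 0 = ∅ := by
  refine Set.eq_empty_of_forall_notMem fun s hs => ?_
  obtain ⟨_, hs⟩ := hs
  by_cases h0 : s.toNNReal = 0
  · rw [h0] at hs
    simp [errorProb, dopplerShift, gaussianReal_zero_var, Measure.real] at hs
    linarith
  · rw [errorProb_of_ne_zero c fc 0 h0] at hs
    simp [dopplerShift] at hs
    linarith

theorem tolerableVariances_eq_Icc {c fc Perr v : ℝ} (hc : 0 < c) (hfc : 0 < fc) (hv : 0 < v)
    (h0 : 0 < Perr) (h1 : Perr < 1 / 2) :
    tolerableVariances c fc Perr v =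
      Set.Icc 0 ((fc * v / (c * erfInv (1 - 2 * Perr))) ^ 2 / 2) := by
  have hd := dopplerShift_pos hc hfc hv
  have hk : 0 < erfInv (1 - 2 * Perr) := erfInv_pos (by linarith) (by linarith)
  have hek := erf_erfInv (y := 1 - 2 * Perr) (by linarith) (by linarith)
  have hd' : dopplerShift c fc v = 2 * (fc * v / c) := by unfold dopplerShift; ring
  set k := erfInv (1 - 2 * Perr)
  ext s
  simp only [tolerableVariances, Set.mem_ofPred_eq, Set.mem_Icc]
  refine and_congr_right fun hs => ?_
  rcases hs.eq_or_lt with rfl | hs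
  -- Variance 0 means Dirac masses, strictly on the correct sides of the threshold.
  · have h3 : errorProb c fc v (0 : ℝ).toNNReal = 0 := by
      simp [errorProb, gaussianReal_zero_var, Measure.real, hd.le, hd]
    rw [h3]
    exact iff_of_true h0.le (by positivity)
  · have hne : s.toNNReal ≠ 0 := by simpa using hs
    have hs2 : 0 < √(2 * s) := by positivity
    have hx : 0 < fc * v / c := by positivity
    rw [errorProb_of_ne_zero c fc v hne, Real.coe_toNNReal _ hs.le, hd',
      mul_div_cancel_left₀ _ two_ne_zero]
    calc (1 - erf (fc * v / c / √(2 * s))) / 2 ≤ Perr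
        ↔ erf k ≤ erf (fc * v / c / √(2 * s)) := by
          rw [hek]; constructor <;> intro h <;> linarith
      _ ↔ √(2 * s) ≤ fc * v / c / k := by
          rw [erf_strictMono.le_iff_le, le_div_iff₀ hs2, le_div_iff₀ hk, mul_comm]
      _ ↔ s ≤ (fc * v / (c * k)) ^ 2 / 2 := by
          rw [Real.sqrt_le_left (by positivity), div_div]
          constructor <;> intro h <;> linarith

/-! ### Moments of inertia of transmission times. -/

/-- A set of times `S` of total length `a` with mean time `m` and central second moment `e`, as
far as the moments of inertia `∫ t in S, (t - t0) ^ 2` can tell. -/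
structure HasInertia (S : Set ℝ) (a m e : ℝ) : Prop where
  measurableSet : MeasurableSet S
  integrableOn (t0 : ℝ) : IntegrableOn (fun t => (t - t0) ^ 2) S
  integral_eq (t0 : ℝ) : ∫ t in S, (t - t0) ^ 2 = a * (t0 - m) ^ 2 + e

theorem HasInertia.congr {S : Set ℝ} {a m e a' m' e' : ℝ} (h : HasInertia S a m e)
    (ha : a = a') (hm : m = m') (he : e = e') : HasInertia S a' m' e' := by
  subst ha hm he; exact h

theorem hasInertia_Ico {x y : ℝ} (hxy : x ≤ y) :
    HasInertia (Set.Ico x y) (y - x) ((x + y) / 2) ((y - x) ^ 3 / 12) where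
  measurableSet := measurableSet_Ico
  integrableOn t0 :=
    ((by fun_prop : Continuous fun t : ℝ => (t - t0) ^ 2).integrableOn_Icc).mono_set
      Set.Ico_subset_Icc_self
  integral_eq t0 := by
    rw [integral_Ico_eq_integral_Ioc, ← intervalIntegral.integral_of_le hxy,
      intervalIntegral.integral_comp_sub_right (fun t => t ^ 2), integral_pow]
    push_cast
    ring

/-- The parallel axis theorem. -/
theorem HasInertia.union {S S' : Set ℝ} {a m e a' m' e' : ℝ} (h : HasInertia S a m e)
    (h' : HasInertia S' a' m' e') (hd : Disjoint S S') (ha : a + a' ≠ 0) :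
    HasInertia (S ∪ S') (a + a') ((a * m + a' * m') / (a + a'))
      (e + e' + a * a' / (a + a') * (m - m') ^ 2) where
  measurableSet := h.measurableSet.union h'.measurableSet
  integrableOn t0 := (h.integrableOn t0).union (h'.integrableOn t0)
  integral_eq t0 := by
    rw [setIntegral_union hd h'.measurableSet (h.integrableOn t0) (h'.integrableOn t0),
      h.integral_eq, h'.integral_eq]
    field_simp
    ring

theorem reflectTimes_zero (s T : ℝ) : reflectTimes s T 0 = ∅ := by simp [reflectTimes]

theorem reflectTimes_succ (s T : ℝ) (L : ℕ) :
    reflectTimes s T (L + 1) = reflectTimes s T L ∪ Set.Ico (s + L * T) (s + L * T + T / 2) := by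
  ext t
  simp only [reflectTimes, Set.mem_ofPred_eq, Set.mem_union, Set.mem_Ico]
  constructor
  · rintro ⟨l, hl, h⟩
    rcases (Nat.lt_succ_iff.1 hl).eq_or_lt with rfl | hl
    · exact .inr h
    · exact .inl ⟨l, hl, h⟩
  · rintro (⟨l, hl, h⟩ | h)
    · exact ⟨l, hl.trans L.lt_succ_self, h⟩
    · exact ⟨L, L.lt_succ_self, h⟩

theorem reflectTimes_subset (s : ℝ) {T : ℝ} (hT : 0 < T) (L : ℕ) :
    reflectTimes s T L ⊆ Set.Ico s (s + L * T) := by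
  rintro t ⟨l, hl, h1, h2⟩
  have h3 : ((l : ℝ) + 1) * T ≤ L * T := by
    gcongr
    exact_mod_cast hl
  have h4 : 0 ≤ (l : ℝ) * T := by positivity
  constructor <;> linarith

/-- Induction appends one half symbol by the parallel axis theorem. Reflecting in first halves moves
the mean back by `T / 4`. The variance of the symbol positions, `T² (L² - 1) / 12`, plus that within
a half symbol, `T² / 48`, gives the correction `-T² / 16`. -/
theorem hasInertia_reflectTimes (s : ℝ) {T : ℝ} (hT : 0 < T) (L : ℕ) :
    HasInertia (reflectTimes s T L) (L * T / 2) (s + L * T / 2 - T / 4)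
      (L * T / 2 * ((L * T) ^ 2 / 12 - T ^ 2 / 16)) := by
  induction L with
  | zero =>
    rw [reflectTimes_zero]
    exact ⟨MeasurableSet.empty, fun _ => integrableOn_empty, fun _ => by simp⟩
  | succ L ih =>
    rw [reflectTimes_succ]
    have hd : Disjoint (reflectTimes s T L) (Set.Ico (s + L * T) (s + L * T + T / 2)) :=
      Set.disjoint_of_subset_left (reflectTimes_subset s hT L)
        (Set.disjoint_left.2 fun t h h' => h.2.not_ge h'.1)
    have hne : ((L : ℝ) + 1) ≠ 0 := by positivity
    have hsum : (L : ℝ) * T / 2 + (s + L * T + T / 2 - (s + L * T)) = (L + 1) * T / 2 := by ring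
    refine (ih.union (hasInertia_Ico (by linarith)) hd ?_).congr ?_ ?_ ?_
    · rw [hsum]; positivity
    · rw [hsum]; push_cast; ring
    · rw [hsum]; push_cast; field_simp; ring
    · rw [hsum]; push_cast; field_simp; ring

/-! ### Sensitivity and the Cramér-Rao bound. -/

theorem norm_deriv_receivedSignal_sq (a : ℝ → ℂ) (t0 ν t : ℝ) :
    ‖deriv (fun ν' : ℝ => receivedSignal a t0 ν' t) ν‖ ^ 2 =
      (2 * Real.pi) ^ 2 * (‖a t‖ ^ 2 * (t - t0) ^ 2) := by
  have h1 : HasDerivAt (fun ν' : ℝ => 2 * Real.pi * ν' * (t - t0)) (2 * Real.pi * (t - t0)) ν := by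
    simpa using ((hasDerivAt_id ν).const_mul (2 * Real.pi)).mul_const (t - t0)
  have h2 := ((h1.ofReal_comp.fun_neg.mul_const Complex.I).cexp).const_mul (a t)
  have h3 : deriv (fun ν' : ℝ => receivedSignal a t0 ν' t) ν = _ := h2.deriv
  rw [h3, ← Complex.ofReal_neg]
  simp only [norm_mul, Complex.norm_exp_ofReal_mul_I, Complex.norm_real, Complex.norm_I,
    mul_pow, norm_neg, Real.norm_eq_abs, sq_abs]
  ring

theorem sensitivity_eq (P : Measure Ω) [IsProbabilityMeasure P] {A : Ω → ℝ → ℂ} {S : Set ℝ}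
    {Q a m e : ℝ} (hA : ∀ ω t, ‖A ω t‖ ^ 2 = S.indicator (fun _ => Q) t)
    (hS : HasInertia S a m e) (ν t0 : ℝ) :
    sensitivity P A ν t0 = (2 * Real.pi) ^ 2 * Q * (a * (t0 - m) ^ 2 + e) := by
  have h : ∀ ω t, ‖deriv (fun ν' : ℝ => receivedSignal (A ω) t0 ν' t) ν‖ ^ 2 =
      (2 * Real.pi) ^ 2 * Q * S.indicator (fun t => (t - t0) ^ 2) t := fun ω t => by
    rw [norm_deriv_receivedSignal_sq, hA]
    by_cases ht : t ∈ S <;> simp [ht, mul_assoc]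
  simp only [sensitivity, h, integral_const_mul, integral_indicator hS.measurableSet,
    hS.integral_eq, integral_const, probReal_univ, one_smul]

theorem mcrb_eq (N0 : ℝ) (P : Measure Ω) [IsProbabilityMeasure P] {A : Ω → ℝ → ℂ} {S : Set ℝ}
    {Q a m e : ℝ} (hA : ∀ ω t, ‖A ω t‖ ^ 2 = S.indicator (fun _ => Q) t)
    (hS : HasInertia S a m e) (hQ : 0 ≤ Q) (ha : 0 ≤ a) (ν : ℝ) :
    mcrb N0 P A ν = N0 / 2 / ((2 * Real.pi) ^ 2 * Q * e) := by
  -- The infimum is attained at the mean time `m`.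
  have h : IsLeast (Set.range fun t0 => sensitivity P A ν t0) ((2 * Real.pi) ^ 2 * Q * e) := by
    refine ⟨⟨m, by simp [sensitivity_eq P hA hS]⟩, ?_⟩
    rintro _ ⟨t0, rfl⟩
    simp only [sensitivity_eq P hA hS]
    gcongr
    nlinarith [mul_nonneg ha (sq_nonneg (t0 - m))]
  rw [mcrb, iInf, h.csInf_eq]

open Classical in
theorem norm_pskAmplitude_sq {PS : ℝ} (hPS : 0 ≤ PS) (W D : Set ℝ) (t : ℝ) :
    ‖pskAmplitude PS W D t‖ ^ 2 = W.indicator (fun _ => PS) t := by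
  by_cases h : t ∈ W <;> by_cases h' : t ∈ D <;>
    simp [pskAmplitude, h, h', Real.sq_sqrt hPS, Complex.exp_pi_mul_I]

open Classical in
theorem norm_askAmplitude_sq {PS : ℝ} (hPS : 0 ≤ PS) (R : Set ℝ) (t : ℝ) :
    ‖askAmplitude PS R t‖ ^ 2 = R.indicator (fun _ => 2 * PS) t := by
  by_cases h : t ∈ R
  · simp only [askAmplitude, h, if_true, Complex.norm_real, Real.norm_eq_abs, sq_abs,
      Set.indicator_of_mem]
    exact Real.sq_sqrt (by positivity)
  · simp [askAmplitude, h]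

/-! ### Threshold speed. -/

theorem minSpeed_pos {c fc N0 PS Perr CT : ℝ} (hc : 0 < c) (hfc : 0 < fc) (hN0 : 0 < N0)
    (hPS : 0 < PS) (h0 : 0 < Perr) (h1 : Perr < 1 / 2) (hCT : 0 < CT) :
    0 < minSpeed c fc Perr N0 PS CT := by
  have hk : 0 < erfInv (1 - 2 * Perr) := erfInv_pos (by linarith) (by linarith)
  unfold minSpeed
  positivity

/-- Covers all four cases: `Q` is `PS` for PSK and `2 * PS` for ASK, so `hCT` makes `CT` equal to
`12 * e` or `24 * e`. -/
theorem isMinimumSpeed_and_isBalancingSpeed (P : Measure Ω) [IsProbabilityMeasure P]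
    {c fc N0 PS Perr Q a m e CT : ℝ} (hc : 0 < c) (hfc : 0 < fc) (hN0 : 0 < N0) (hPS : 0 < PS)
    (h0 : 0 < Perr) (h1 : Perr < 1 / 2) {A : Ω → ℝ → ℂ} {S : Set ℝ}
    (hA : ∀ ω t, ‖A ω t‖ ^ 2 = S.indicator (fun _ => Q) t)
    (hS : HasInertia S a m e) (hQ : 0 < Q) (ha : 0 ≤ a) (he : 0 < e)
    (hCT : PS * CT = 12 * Q * e) :
    IsMinimumSpeed c fc Perr N0 P A (minSpeed c fc Perr N0 PS CT) ∧
      IsBalancingSpeed c fc Perr N0 P A (minSpeed c fc Perr N0 PS CT) := by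
  have hCT0 : 0 < CT := pos_of_mul_pos_right (hCT ▸ by positivity : 0 < PS * CT) hPS.le
  have hk : 0 < erfInv (1 - 2 * Perr) := erfInv_pos (by linarith) (by linarith)
  have hw := minSpeed_pos hc hfc hN0 hPS h0 h1 hCT0
  -- The bound is the largest tolerable variance at the claimed speed, so comparing variances
  -- becomes comparing speeds.
  have hB : ∀ ν, mcrb N0 P A ν =
      (fc * minSpeed c fc Perr N0 PS CT / (c * erfInv (1 - 2 * Perr))) ^ 2 / 2 := fun ν => by
    have hsq : √(3 / CT * (N0 / PS)) ^ 2 = N0 / (4 * Q * e) := by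
      rw [Real.sq_sqrt (by positivity), div_mul_div_comm, mul_comm CT, hCT]
      field_simp
      norm_num
    have hred : fc * minSpeed c fc Perr N0 PS CT / (c * erfInv (1 - 2 * Perr)) =
        √(3 / CT * (N0 / PS)) / Real.pi := by
      unfold minSpeed
      field_simp
    rw [mcrb_eq N0 P hA hS hQ.le ha, hred, div_pow, hsq]
    field_simp
    norm_num
  set w := minSpeed c fc Perr N0 PS CT
  have hmono : ∀ {x y : ℝ}, 0 < x → 0 < y →
      ((fc * x / (c * erfInv (1 - 2 * Perr))) ^ 2 / 2 ≤
        (fc * y / (c * erfInv (1 - 2 * Perr))) ^ 2 / 2 ↔ x ≤ y) := fun hx hy => by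
    rw [div_le_div_iff_of_pos_right two_pos, pow_le_pow_iff_left₀ (by positivity) (by positivity)
      two_ne_zero, div_le_div_iff_of_pos_right (by positivity), mul_le_mul_iff_right₀ hfc]
  have hpos : ∀ {v : ℝ}, 0 < v → (MotionDetectionPossible c fc Perr N0 P A v ↔ w ≤ v) :=
    fun {v} hv => by
      simp only [MotionDetectionPossible, tolerableVariances_eq_Icc hc hfc hv h0 h1, hB, and_self]
      rw [← hmono hw hv]
      exact ⟨fun ⟨s, hs, h⟩ => h.trans hs.2, fun h => ⟨_, ⟨by positivity, le_rfl⟩, h⟩⟩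
  refine ⟨⟨⟨hw.le, (hpos hw).2 le_rfl⟩, ?_⟩, hw, fun v hv => ?_⟩
  · rintro v ⟨hv, h⟩
    rcases hv.eq_or_lt with rfl | hv
    · obtain ⟨s, hs, _⟩ := h
      rw [tolerableVariances_zero c fc h1] at hs
      exact hs.elim
    · exact (hpos hv).1 h
  · rw [tolerableVariances_eq_Icc hc hfc hv h0 h1, hB]
    constructor
    · rintro ⟨hl, hu⟩
      exact le_antisymm ((hmono hv hw).1 (hu ⟨by positivity, le_rfl⟩)) ((hmono hw hv).1 hl.2)
    · rintro rfl
      exact isGreatest_Icc (by positivity)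

theorem tendsto_minSpeed {ι : Type*} {l : Filter ι} {C : ι → ℝ} (c fc Perr N0 PS : ℝ) {CT : ℝ}
    (hCT : CT ≠ 0) (h : Tendsto C l (𝓝 CT)) :
    Tendsto (fun i => minSpeed c fc Perr N0 PS (C i)) l (𝓝 (minSpeed c fc Perr N0 PS CT)) :=
  ((((tendsto_const_nhds (x := (3 : ℝ))).div h hCT).mul_const _).sqrt).const_mul _

/-! ### Timing constants and their many-symbol limits. -/

theorem hasInertia_reflectTimes_div (s : ℝ) {D : ℝ} (hD : 0 < D) {L : ℕ} (hL : 1 ≤ L) :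
    HasInertia (reflectTimes s (D / L) L) (D / 2) (s + D / 2 - D / L / 4)
      (D / 2 * (D ^ 2 / 12 - (D / L) ^ 2 / 16)) := by
  have hL' : (0 : ℝ) < L := by exact_mod_cast hL
  have h : (L : ℝ) * (D / L) = D := by field_simp
  have := hasInertia_reflectTimes s (div_pos hD hL') L
  rwa [h] at this

theorem inertia_reflectTimes_div_pos {D : ℝ} (hD : 0 < D) {L : ℕ} (hL : 1 ≤ L) :
    0 < D / 2 * (D ^ 2 / 12 - (D / L) ^ 2 / 16) := by
  have hL' : (1 : ℝ) ≤ L := by exact_mod_cast hL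
  have h : (D / L) ^ 2 ≤ D ^ 2 := by
    gcongr
    exact div_le_self hD.le hL'
  have : 0 < D ^ 2 := by positivity
  exact mul_pos (by positivity) (by linarith)

theorem disjoint_twoSignalReflect {T1 T2 Tpause : ℝ} (hT1 : 0 < T1) (hT2 : 0 < T2)
    (hp : 0 ≤ Tpause) {L1 L2 : ℕ} (hL1 : 1 ≤ L1) (hL2 : 1 ≤ L2) :
    Disjoint (reflectTimes 0 (T1 / L1) L1) (reflectTimes (T1 + Tpause) (T2 / L2) L2) := by
  have h1 : (0 : ℝ) < L1 := by exact_mod_cast hL1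
  have h2 : (0 : ℝ) < L2 := by exact_mod_cast hL2
  refine Set.disjoint_left.2 fun t h h' => ?_
  have h := (reflectTimes_subset 0 (div_pos hT1 h1) L1 h).2
  have h' := (reflectTimes_subset _ (div_pos hT2 h2) L2 h').1
  rw [zero_add, mul_div_cancel₀ _ h1.ne'] at h
  linarith

/-- The centres are `(T1 + T2) / 2 + Tpause` apart. The pause-free part of the cross term completes
`T1³ + T2³` to `(T1 + T2)³`; the rest is the pause term. -/
theorem hasInertia_twoSignalWindow {T1 T2 Tpause : ℝ} (hT1 : 0 < T1) (hT2 : 0 < T2)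
    (hp : 0 ≤ Tpause) : ∃ m, HasInertia (twoSignalWindow T1 T2 Tpause) (T1 + T2) m
      (twoSignalConst T1 T2 Tpause / 12) := by
  have hd : Disjoint (Set.Ico 0 T1) (Set.Ico (T1 + Tpause) (T1 + Tpause + T2)) :=
    Set.disjoint_left.2 fun t h h' => by linarith [h.2, h'.1]
  have hsum : T1 - 0 + (T1 + Tpause + T2 - (T1 + Tpause)) = T1 + T2 := by ring
  have h := (hasInertia_Ico hT1.le).union
    (hasInertia_Ico (by linarith : T1 + Tpause ≤ T1 + Tpause + T2)) hd (by rw [hsum]; positivity)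
  refine ⟨_, h.congr hsum rfl ?_⟩
  rw [hsum, twoSignalConst]
  field_simp
  ring

theorem twoSignalConst_pos {T1 T2 Tpause : ℝ} (hT1 : 0 < T1) (hT2 : 0 < T2) (hp : 0 ≤ Tpause) :
    0 < twoSignalConst T1 T2 Tpause := by unfold twoSignalConst; positivity

/-- The timing constant of one ASK signal with `L` symbols. -/
noncomputable def askOneSignalConst (T0 : ℝ) (L : ℕ) : ℝ :=
  24 * (T0 / 2 * (T0 ^ 2 / 12 - (T0 / L) ^ 2 / 16))

/-- The timing constant of two ASK signals with `L1` and `L2` symbols. -/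
noncomputable def askTwoSignalConst (T1 T2 Tpause : ℝ) (L1 L2 : ℕ) : ℝ :=
  24 * (T1 / 2 * (T1 ^ 2 / 12 - (T1 / L1) ^ 2 / 16) + T2 / 2 * (T2 ^ 2 / 12 - (T2 / L2) ^ 2 / 16) +
    T1 / 2 * (T2 / 2) / (T1 / 2 + T2 / 2) *
      (0 + T1 / 2 - T1 / L1 / 4 - (T1 + Tpause + T2 / 2 - T2 / L2 / 4)) ^ 2)

theorem tendsto_askOneSignalConst (T0 : ℝ) :
    Tendsto (askOneSignalConst T0) atTop (𝓝 (oneSignalConst T0)) := by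
  have h := tendsto_const_div_atTop_nhds_zero_nat T0
  have h' := ((((h.pow 2).div_const 16).const_sub (T0 ^ 2 / 12)).const_mul (T0 / 2)).const_mul 24
  convert h' using 2
  · rfl
  · rw [oneSignalConst]
    ring

theorem tendsto_askTwoSignalConst {T1 T2 : ℝ} (Tpause : ℝ) (hT1 : 0 < T1) (hT2 : 0 < T2) :
    Tendsto (fun L : ℕ × ℕ => askTwoSignalConst T1 T2 Tpause L.1 L.2) (atTop ×ˢ atTop)
      (𝓝 (twoSignalConst T1 T2 Tpause)) := by
  have h1 : Tendsto (fun L : ℕ × ℕ => T1 / (L.1 : ℝ)) (atTop ×ˢ atTop) (𝓝 0) :=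
    (tendsto_const_div_atTop_nhds_zero_nat T1).comp tendsto_fst
  have h2 : Tendsto (fun L : ℕ × ℕ => T2 / (L.2 : ℝ)) (atTop ×ˢ atTop) (𝓝 0) :=
    (tendsto_const_div_atTop_nhds_zero_nat T2).comp tendsto_snd
  have e1 := (((h1.pow 2).div_const 16).const_sub (T1 ^ 2 / 12)).const_mul (T1 / 2)
  have e2 := (((h2.pow 2).div_const 16).const_sub (T2 ^ 2 / 12)).const_mul (T2 / 2)
  have e3 := ((((h1.div_const 4).const_sub (0 + T1 / 2)).sub
    ((h2.div_const 4).const_sub (T1 + Tpause + T2 / 2))).pow 2).const_mul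
      (T1 / 2 * (T2 / 2) / (T1 / 2 + T2 / 2))
  convert ((e1.add e2).add e3).const_mul 24 using 2
  · rfl
  -- At symbol length 0, the halved durations and the factor 24 reproduce the PSK constant.
  · rw [twoSignalConst]
    field_simp
    ring

end RFID

theorem theorem3 {Ω : Type*} [MeasurableSpace Ω] (P : Measure Ω) [IsProbabilityMeasure P]
    (c fc N0 PS Perr : ℝ) (hc : 0 < c) (hfc : 0 < fc) (hN0 : 0 < N0) (hPS : 0 < PS)
    (hPerr : 0 < Perr) (hPerr' : Perr < 1 / 2) :
    -- one tag signal
    (∀ T0 : ℝ, 0 < T0 →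
      -- PSK, with arbitrary (random) data
      (∀ data : Ω → Set ℝ,
        RFID.IsMinimumSpeed c fc Perr N0 P
          (fun ω => RFID.pskAmplitude PS (RFID.oneSignalWindow T0) (data ω))
          (RFID.minSpeed c fc Perr N0 PS (RFID.oneSignalConst T0)) ∧
        RFID.IsBalancingSpeed c fc Perr N0 P
          (fun ω => RFID.pskAmplitude PS (RFID.oneSignalWindow T0) (data ω))
          (RFID.minSpeed c fc Perr N0 PS (RFID.oneSignalConst T0))) ∧
      -- ASK, in the limit of many symbols
      (∃ w : ℕ → ℝ,
        (∀ L : ℕ, 1 ≤ L →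
          RFID.IsMinimumSpeed c fc Perr N0 P
            (fun _ => RFID.askAmplitude PS (RFID.oneSignalReflect T0 L)) (w L) ∧
          RFID.IsBalancingSpeed c fc Perr N0 P
            (fun _ => RFID.askAmplitude PS (RFID.oneSignalReflect T0 L)) (w L)) ∧
        Tendsto w atTop (𝓝 (RFID.minSpeed c fc Perr N0 PS (RFID.oneSignalConst T0))))) ∧
    -- two tag signals
    (∀ T1 T2 Tpause : ℝ, 0 < T1 → 0 < T2 → 0 ≤ Tpause →
      (∀ data : Ω → Set ℝ,
        RFID.IsMinimumSpeed c fc Perr N0 P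
          (fun ω => RFID.pskAmplitude PS (RFID.twoSignalWindow T1 T2 Tpause) (data ω))
          (RFID.minSpeed c fc Perr N0 PS (RFID.twoSignalConst T1 T2 Tpause)) ∧
        RFID.IsBalancingSpeed c fc Perr N0 P
          (fun ω => RFID.pskAmplitude PS (RFID.twoSignalWindow T1 T2 Tpause) (data ω))
          (RFID.minSpeed c fc Perr N0 PS (RFID.twoSignalConst T1 T2 Tpause))) ∧
      (∃ w : ℕ × ℕ → ℝ,
        (∀ L1 L2 : ℕ, 1 ≤ L1 → 1 ≤ L2 →
          RFID.IsMinimumSpeed c fc Perr N0 P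
            (fun _ => RFID.askAmplitude PS (RFID.twoSignalReflect T1 T2 Tpause L1 L2))
            (w (L1, L2)) ∧
          RFID.IsBalancingSpeed c fc Perr N0 P
            (fun _ => RFID.askAmplitude PS (RFID.twoSignalReflect T1 T2 Tpause L1 L2))
            (w (L1, L2))) ∧
        Tendsto w (atTop ×ˢ atTop)
          (𝓝 (RFID.minSpeed c fc Perr N0 PS (RFID.twoSignalConst T1 T2 Tpause))))) := by
  refine ⟨fun T0 hT0 => ⟨fun data => ?_,
    fun L => RFID.minSpeed c fc Perr N0 PS (RFID.askOneSignalConst T0 L), fun L hL => ?_,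
    RFID.tendsto_minSpeed _ _ _ _ _ (pow_pos hT0 3).ne' (RFID.tendsto_askOneSignalConst T0)⟩,
    fun T1 T2 Tpause hT1 hT2 hp => ⟨fun data => ?_,
    fun L => RFID.minSpeed c fc Perr N0 PS (RFID.askTwoSignalConst T1 T2 Tpause L.1 L.2),
    fun L1 L2 hL1 hL2 => ?_,
    RFID.tendsto_minSpeed _ _ _ _ _ (RFID.twoSignalConst_pos hT1 hT2 hp).ne'
      (RFID.tendsto_askTwoSignalConst Tpause hT1 hT2)⟩⟩
  · refine RFID.isMinimumSpeed_and_isBalancingSpeed P hc hfc hN0 hPS hPerr hPerr'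
      (fun ω t => RFID.norm_pskAmplitude_sq hPS.le _ _ t) (RFID.hasInertia_Ico hT0.le) hPS
      (by linarith) (by simpa using by positivity) ?_
    rw [RFID.oneSignalConst]
    ring
  · refine RFID.isMinimumSpeed_and_isBalancingSpeed P hc hfc hN0 hPS hPerr hPerr'
      (fun _ t => RFID.norm_askAmplitude_sq hPS.le _ t)
      (RFID.hasInertia_reflectTimes_div 0 hT0 hL) (by positivity) (by positivity)
      (RFID.inertia_reflectTimes_div_pos hT0 hL) ?_
    rw [RFID.askOneSignalConst]
    ring
  · obtain ⟨m, hm⟩ := RFID.hasInertia_twoSignalWindow hT1 hT2 hp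
    have hC := RFID.twoSignalConst_pos hT1 hT2 hp
    exact RFID.isMinimumSpeed_and_isBalancingSpeed P hc hfc hN0 hPS hPerr hPerr'
      (fun ω t => RFID.norm_pskAmplitude_sq hPS.le _ _ t) hm hPS
      (by positivity) (by positivity) (by ring)
  · have e1 := RFID.inertia_reflectTimes_div_pos hT1 hL1
    have e2 := RFID.inertia_reflectTimes_div_pos hT2 hL2
    refine RFID.isMinimumSpeed_and_isBalancingSpeed P hc hfc hN0 hPS hPerr hPerr'
      (fun _ t => RFID.norm_askAmplitude_sq hPS.le _ t)
      ((RFID.hasInertia_reflectTimes_div 0 hT1 hL1).union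
        (RFID.hasInertia_reflectTimes_div (T1 + Tpause) hT2 hL2)
        (RFID.disjoint_twoSignalReflect hT1 hT2 hp hL1 hL2) (by positivity))
      (by positivity) (by positivity) (add_pos_of_pos_of_nonneg (add_pos e1 e2) (by positivity)) ?_
    simp only [RFID.askTwoSignalConst]
    ring
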